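/- Let $H$ be a real Hilbert space with inner product $(\cdot,\cdot)_H$, let $T>0$, and let $\mathcal F:[0,T]\times H\to H$ be continuous. Let $H_m\subset H$ be a finite-dimensional subspace with $H$-orthogonal projection $\pi_m:H\to H_m$, let $t_{m-1}\in[0,T)$ be a time node, and let $U_{m-1}\in H$ (for the cG scheme) and $U_{m-1}^-\in H$ (for the dG scheme) be given values. For $k_m>0$ with $t_m:=t_{m-1}+k_m\le T$ put $I_m=(t_{m-1},t_m)$, and for $r\in\mathbb N_0$ let $\mathcal P^r(I_m;H_m)$ be the space of functions $p\in C^0(\overline{I_m};H_m)$ of the form $p(t)=\sum_{i=0}^r x_it^i$ with $x_i\in H_m$. For a continuous function $V$ on $\overline{I_m}$ write $V_{m-1}^+=\lim_{s\searrow0}V(t_{m-1}+s)$. Then there is a constant $k_{\max}>0$, depending on $\mathcal F$, $T$, $H_m$, $t_{m-1}$, $U_{m-1}$ and $U_{m-1}^-$ but not on any polynomial degree, such that for every $0<k_m\le k_{\max}$ with $t_{m-1}+k_m\le T$ and every $r_m\in\mathbb N_0$ the following hold. (cG) There is at least one $U\in\mathcal P^{r_m+1}(I_m;H_m)$ with $U(t_{m-1})=\pi_mU_{m-1}$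 and $$\int_{I_m}(U'(t),V(t))_H\,dt=\int_{I_m}(\mathcal F(t,U(t)),V(t))_H\,dt\qquad\forall V\in\mathcal P^{r_m}(I_m;H_m).$$ (dG) There is at least one $U\in\mathcal P^{r_m}(I_m;H_m)$ with $$\int_{I_m}(U'(t),V(t))_H\,dt+(U_{m-1}^+-U_{m-1}^-,V_{m-1}^+)_H=\int_{I_m}(\mathcal F(t,U(t)),V(t))_H\,dt\qquad\forall V\in\mathcal P^{r_m}(I_m;H_m).$$ -/

import Mathlib

namespace GalerkinTimeStepping

variable {H : Type*} [NormedAddCommGroup H] [InnerProductSpace ℝ H]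

/-- The space `𝒫^r(J; X)` of polynomials of degree at most `r` on the closure of `J`, with
coefficients in the subspace `X` of `H`. Its elements are represented by functions on `ℝ`;
the values outside the closure of `J` are irrelevant. -/
def polySpace (r : ℕ) (J : Set ℝ) (X : Submodule ℝ H) : Set (ℝ → H) :=
  {p | ContinuousOn p (closure J) ∧
    ∃ x : Fin (r + 1) → X, ∀ t ∈ closure J, p t = ∑ i : Fin (r + 1), t ^ (i : ℕ) • (x i : H)}

/-- `U` solves the local `hp`-cG problem on `I = (a, a + k)` for the nonlinearity `F`, the
finite-dimensional space `Hm`, the degree `r` and the given value `Uprev` at the node `a`. -/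
structure IsCGSolution (F : ℝ → H → H) (Hm : Submodule ℝ H) [FiniteDimensional ℝ Hm]
    (a k : ℝ) (r : ℕ) (Uprev : H) (U : ℝ → H) : Prop where
  mem : U ∈ polySpace (r + 1) (Set.Ioo a (a + k)) Hm
  initial : U a = Hm.starProjection Uprev
  weak : ∀ V ∈ polySpace r (Set.Ioo a (a + k)) Hm,
    ∫ t in Set.Ioo a (a + k), inner ℝ (deriv U t) (V t) =
      ∫ t in Set.Ioo a (a + k), inner ℝ (F t (U t)) (V t)

/-- `U` solves the local `hp`-dG problem on `I = (a, a + k)` for the nonlinearity `F`, the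
finite-dimensional space `Hm`, the degree `r` and the given left-hand limit `Uprev` at the
node `a`. The jump at `a` is the right-hand limit of `U` at `a` minus `Uprev`. -/
structure IsDGSolution (F : ℝ → H → H) (Hm : Submodule ℝ H)
    (a k : ℝ) (r : ℕ) (Uprev : H) (U : ℝ → H) : Prop where
  mem : U ∈ polySpace r (Set.Ioo a (a + k)) Hm
  weak : ∀ V ∈ polySpace r (Set.Ioo a (a + k)) Hm,
    (∫ t in Set.Ioo a (a + k), inner ℝ (deriv U t) (V t)) +
        inner ℝ (Function.rightLim U a - Uprev) (Function.rightLim V a) =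
      ∫ t in Set.Ioo a (a + k), inner ℝ (F t (U t)) (V t)

end GalerkinTimeStepping

/-! Since test functions take values in `Hm`, the nonlinearity may be replaced by its projection.
With `u₀` the projected initial value, write `U(a + k s) = u₀ + W(s)`; the right-hand side becomes
`k` times a continuous map on the unit interval. Truncating its argument to the unit ball around
`u₀` makes it bounded by `m = k M`.

Existence for the truncated problem is Brouwer's theorem in coefficient space: the linear part is
invertible and the right-hand side is continuous and bounded (`exists_variational_solution`). Once
`‖W‖ ≤ 1` is known, the truncation is inactive and `U` solves the original problem. The point is
therefore a bound on `W` by a multiple of `m` independent of the degree.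

For cG, testing with `W'` gives `∫ ‖W'‖² ≤ m ∫ ‖W'‖`, so `‖W‖ ≤ m` as `W 0 = 0` (`norm_le_of_cg`).
For dG, let `ρ` be the Radau polynomial of degree `r + 1`, with `ρ 0 = 1`, `ρ 1 = 0` and `|ρ| ≤ 1`.
Against polynomials of degree at most `r`, `-ρ'` acts as evaluation at `0`, so `W - ρ W(0)`
satisfies the cG relation and is bounded by `m`. Testing with `W` then controls `W 0`, giving `‖W‖ ≤
4 m` (`norm_le_of_dg`). Applied with zero right-hand side, the same bounds give invertibility of the
linear parts. -/

namespace GalerkinTimeStepping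

open MeasureTheory Set Metric
open scoped NNReal

/-! ### Brouwer's fixed point theorem, by an analytic volume argument -/

section Brouwer

variable {E : Type*} [NormedAddCommGroup E] [InnerProductSpace ℝ E]

/-- A Lipschitz map on a closed ball that vanishes on the sphere extends by zero to a globally
Lipschitz map. -/
theorem lipschitzWith_indicator_ball {R : ℝ} {K : ℝ≥0} {g : E → E}
    (hg : LipschitzOnWith K g (closedBall 0 R)) (h0 : ∀ x, ‖x‖ = R → g x = 0) :
    LipschitzWith K ((ball (0 : E) R).indicator g) := by
  have key : ∀ x y : E, ‖x‖ < R → R ≤ ‖y‖ → ‖g x‖ ≤ K * ‖x - y‖ := by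
    intro x y hx hy
    -- The segment from `x` to `y` crosses the sphere, where `g` vanishes; the crossing point is no
    -- farther from `x` than `y` is.
    have hc : ContinuousOn (fun s : ℝ => ‖x + s • (y - x)‖) (Icc 0 1) := by fun_prop
    obtain ⟨s, hs, hsR⟩ := intermediate_value_Icc (zero_le_one' ℝ) hc
      (show R ∈ Icc _ _ from ⟨by simpa using hx.le, by simpa using hy⟩)
    have h1 := hg.dist_le_mul x (by simpa using hx.le) (x + s • (y - x))
      (by simpa using hsR.le)
    rw [h0 _ hsR, dist_zero_right, dist_self_add_right, norm_smul, Real.norm_eq_abs,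
      abs_of_nonneg hs.1, norm_sub_rev y x] at h1
    refine h1.trans (mul_le_mul_of_nonneg_left ?_ K.2)
    exact mul_le_of_le_one_left (norm_nonneg _) hs.2
  refine LipschitzWith.of_dist_le_mul fun x y => ?_
  by_cases hx : x ∈ ball (0 : E) R <;> by_cases hy : y ∈ ball (0 : E) R
  · rw [indicator_of_mem hx, indicator_of_mem hy]
    exact hg.dist_le_mul x (ball_subset_closedBall hx) y (ball_subset_closedBall hy)
  · rw [indicator_of_mem hx, indicator_of_notMem hy, dist_zero_right, dist_eq_norm]
    exact key x y (by simpa using hx) (by simpa using hy)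
  · rw [indicator_of_notMem hx, indicator_of_mem hy, dist_zero_left, dist_comm, dist_eq_norm]
    exact key y x (by simpa using hy) (by simpa using hx)
  · rw [indicator_of_notMem hx, indicator_of_notMem hy, dist_self]
    positivity

/-- A perturbation of the identity by a small Lipschitz map supported in a ball maps the ball
bijectively onto itself. -/
theorem bijOn_ball_id_add [CompleteSpace E] {R : ℝ} {K : ℝ≥0} {g : E → E}
    (hg : LipschitzOnWith K g (closedBall 0 R)) (h0 : ∀ x, ‖x‖ = R → g x = 0)
    {t : ℝ} (ht : 0 ≤ t) (htK : t * K < 1) :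
    BijOn (fun x => x + t • g x) (ball 0 R) (ball 0 R) := by
  have hL := lipschitzWith_indicator_ball hg h0
  set G := (ball (0 : E) R).indicator g with hG
  let f : E → E := fun x => x + t • G x
  let c : ℝ≥0 := ⟨t, ht⟩ * K
  have hc : c < 1 := by exact_mod_cast htK
  have hf : ApproximatesLinearOn f ((ContinuousLinearEquiv.refl ℝ E : E ≃L[ℝ] E) : E →L[ℝ] E)
      univ c := by
    intro x _ y _
    have h1 : f x - f y - ((ContinuousLinearEquiv.refl ℝ E : E ≃L[ℝ] E) : E →L[ℝ] E) (x - y)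
        = t • (G x - G y) := by
      simp only [f, ContinuousLinearEquiv.coe_refl, ContinuousLinearMap.id_apply, smul_sub]
      abel
    rw [h1, norm_smul, Real.norm_eq_abs, abs_of_nonneg ht]
    have h2 := hL.dist_le_mul x y
    rw [dist_eq_norm, dist_eq_norm] at h2
    calc t * ‖G x - G y‖ ≤ t * (K * ‖x - y‖) := mul_le_mul_of_nonneg_left h2 ht
      _ = (c : ℝ) * ‖x - y‖ := by rw [← mul_assoc]; rfl
  have hN : Subsingleton E ∨
      c < ‖((ContinuousLinearEquiv.refl ℝ E : E ≃L[ℝ] E).symm : E →L[ℝ] E)‖₊⁻¹ := by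
    rcases subsingleton_or_nontrivial E with h | h
    · exact Or.inl h
    · right
      have : ‖((ContinuousLinearEquiv.refl ℝ E : E ≃L[ℝ] E).symm : E →L[ℝ] E)‖₊ = 1 := by
        ext
        simp
      rw [this, inv_one]
      exact hc
  have hinj : Function.Injective f := by
    have := hf.injOn hN
    exact injOn_univ.1 this
  have hsurj := hf.surjective hN
  have hout : ∀ x, x ∉ ball (0 : E) R → f x = x := fun x hx => by
    simp [f, hG, indicator_of_notMem hx]
  have hin : EqOn f (fun x => x + t • g x) (ball 0 R) := fun x hx => by
    simp only [f, hG, indicator_of_mem hx]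
  -- `f` is a bijection of the whole space that fixes every point outside the ball, so it must
  -- preserve the ball.
  refine BijOn.congr ⟨?_, hinj.injOn, ?_⟩ hin
  · intro x hx
    by_contra hfx
    exact hfx ((hinj (hout _ hfx)).symm ▸ hx)
  · intro y hy
    obtain ⟨x, rfl⟩ := hsurj y
    refine ⟨x, ?_, rfl⟩
    by_contra hx
    rw [hout x hx] at hy
    exact hx hy

variable [FiniteDimensional ℝ E]

/-- Along the path `1 + s • B`, `0 ≤ s ≤ 1`, a kernel vector would contradict `‖B‖ < 1`, so the
determinant keeps the sign it has at the identity. -/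
theorem det_one_add_pos {B : E →L[ℝ] E} (hB : ‖B‖ < 1) : 0 < (1 + B).det := by
  have hne : ∀ s ∈ Icc (0 : ℝ) 1, (1 + s • B).det ≠ 0 := by
    intro s hs h
    have hk := (LinearMap.bot_lt_ker_of_det_eq_zero h).ne'
    obtain ⟨x, hx, hx0⟩ := (Submodule.ne_bot_iff _).1 hk
    have hx' : x = -(s • B x) := by
      have : x + s • B x = 0 := hx
      exact eq_neg_of_add_eq_zero_left this
    have hpos : 0 < ‖x‖ := norm_pos_iff.2 hx0
    have h1 : ‖x‖ ≤ ‖B‖ * ‖x‖ := by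
      calc ‖x‖ = s * ‖B x‖ := by
            conv_lhs => rw [hx']
            rw [norm_neg, norm_smul, Real.norm_eq_abs, abs_of_nonneg hs.1]
        _ ≤ ‖B x‖ := mul_le_of_le_one_left (norm_nonneg _) hs.2
        _ ≤ _ := B.le_opNorm x
    nlinarith
  have hcont : ContinuousOn (fun s : ℝ => (1 + s • B).det) (Icc 0 1) := by
    have := ContinuousLinearMap.continuous_det (𝕜 := ℝ) (E := E)
    exact (this.comp (by fun_prop : Continuous fun s : ℝ => (1 + s • B))).continuousOn
  by_contra! hle
  have h0 : (1 + (0 : ℝ) • B).det = 1 := by simp [ContinuousLinearMap.det]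
  obtain ⟨s, hs, hs0⟩ := intermediate_value_Icc' (zero_le_one' ℝ) hcont
    (show (0 : ℝ) ∈ Icc _ _ from ⟨by simpa using hle, by rw [h0]; exact zero_le_one⟩)
  exact hne s hs hs0

/-- The determinant of `1 + t A` at `t = 1` is a combination, with weights that do not depend on
`A`, of its values at `n + 1` small times, where `n` is the dimension. -/
theorem exists_det_one_add_eq_sum {τ : ℝ} (hτ : 0 < τ) :
    ∃ (n : ℕ) (t c : ℕ → ℝ), (∀ i, 0 ≤ t i ∧ t i < τ) ∧
      ∀ A : E →L[ℝ] E, (1 + A).det = ∑ i ∈ Finset.range n, c i * (1 + t i • A).det := by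
  let d := Module.finrank ℝ E
  let b := Module.finBasis ℝ E
  -- The shift by `2` keeps every node strictly below `τ`, including the one with index `0`.
  let t : ℕ → ℝ := fun i => τ / (i + 2)
  have ht : Function.Injective t := by
    intro i j hij
    simp only [t] at hij
    have hi : (0 : ℝ) < i + 2 := by positivity
    have hj : (0 : ℝ) < j + 2 := by positivity
    rw [div_eq_div_iff hi.ne' hj.ne'] at hij
    have := mul_left_cancel₀ hτ.ne' hij
    exact_mod_cast (add_right_cancel this).symm
  refine ⟨d + 1, t, fun i => ((Lagrange.basis (Finset.range (d + 1)) t i).eval 1), ?_, ?_⟩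
  · intro i
    have hi : (0 : ℝ) < i + 2 := by positivity
    refine ⟨by positivity, ?_⟩
    rw [div_lt_iff₀ hi]
    nlinarith [(Nat.cast_nonneg i : (0 : ℝ) ≤ i)]
  · intro A
    let M := LinearMap.toMatrix b b (A : E →ₗ[ℝ] E)
    -- As a function of `s`, `det (1 + s A)` is a polynomial of degree at most `d`, so Lagrange
    -- interpolation at `d + 1` nodes recovers its value at `1`.
    let p : Polynomial ℝ := Matrix.det ((Polynomial.X : Polynomial ℝ) • M.map Polynomial.C
      + (1 : Matrix (Fin d) (Fin d) ℝ).map Polynomial.C)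
    have hp : ∀ s : ℝ, p.eval s = (1 + s • A).det := by
      intro s
      have h1 : (1 + s • A).det
          = (LinearMap.toMatrix b b ((1 + s • A : E →L[ℝ] E) : E →ₗ[ℝ] E)).det :=
        (LinearMap.det_toMatrix b _).symm
      have h2 : LinearMap.toMatrix b b ((1 + s • A : E →L[ℝ] E) : E →ₗ[ℝ] E) = 1 + s • M := by
        have h3 : ((1 + s • A : E →L[ℝ] E) : E →ₗ[ℝ] E) = 1 + s • (A : E →ₗ[ℝ] E) := rfl
        rw [h3, map_add, map_smul, LinearMap.toMatrix_one]
      rw [h1, h2, ← Polynomial.coe_evalRingHom, RingHom.map_det]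
      congr 1
      ext i j
      by_cases hij : i = j <;> simp [hij] <;> ring
    have hdeg : p.degree < ((Finset.range (d + 1)).card : ℕ) := by
      refine lt_of_le_of_lt Polynomial.degree_le_natDegree ?_
      have := Polynomial.natDegree_det_X_add_C_le M 1
      rw [Finset.card_range]
      rw [Fintype.card_fin] at this
      exact_mod_cast Nat.lt_succ_of_le this
    have hint := Lagrange.eq_interpolate (s := Finset.range (d + 1)) ht.injOn hdeg
    have h1 := congrArg (Polynomial.eval 1) hint
    rw [hp, one_smul, Lagrange.interpolate_apply, Polynomial.eval_finsetSum] at h1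
    rw [h1]
    refine Finset.sum_congr rfl fun i _ => ?_
    rw [Polynomial.eval_mul, Polynomial.eval_C, hp, mul_comm]

/-- There is no continuously differentiable retraction of a ball onto its boundary sphere. -/
theorem not_contDiff_retraction_sphere {R : ℝ} (hR : 0 < R) {r : E → E} (hr : ContDiff ℝ 1 r)
    (hnorm : ∀ x, ‖r x‖ = R) (hid : ∀ x, ‖x‖ = R → r x = x) : False := by
  borelize E
  let g : E → E := fun x => r x - x
  have hg : ContDiff ℝ 1 g := hr.sub contDiff_id
  have hg0 : ∀ x, ‖x‖ = R → g x = 0 := fun x hx => by simp [g, hid x hx]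
  obtain ⟨K, hK⟩ := hg.contDiffOn.exists_lipschitzOnWith one_ne_zero
    (convex_closedBall (0 : E) R) (isCompact_closedBall _ _)
  have hder : ∀ x, HasFDerivAt g (fderiv ℝ g x) x := fun x =>
    (hg.differentiable one_ne_zero x).hasFDerivAt
  have hcont : ∀ t : ℝ, Continuous fun x => (1 + t • fderiv ℝ g x).det := fun t =>
    (ContinuousLinearMap.continuous_det (𝕜 := ℝ) (E := E)).comp
      (continuous_const.add ((hg.continuous_fderiv one_ne_zero).const_smul t))
  have hint : ∀ t : ℝ, IntegrableOn (fun x => (1 + t • fderiv ℝ g x).det) (ball 0 R) := fun t =>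
    ((hcont t).continuousOn.integrableOn_compact (isCompact_closedBall _ _)).mono_set
      ball_subset_closedBall
  -- For small `t`, `x ↦ x + t g(x)` maps the ball bijectively onto itself with positive Jacobian,
  -- so the change of variables formula returns the volume of the ball.
  have hvol : ∀ t : ℝ, 0 ≤ t → t < 1 / (K + 1) →
      ∫ x in ball (0 : E) R, (1 + t • fderiv ℝ g x).det = volume.real (ball (0 : E) R) := by
    intro t ht htK
    have hK1 : (0 : ℝ) < K + 1 := by positivity
    rw [lt_div_iff₀ hK1] at htK
    have htK' : t * K < 1 := by linarith
    have hb := bijOn_ball_id_add hK hg0 ht htK'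
    have h1 := integral_image_eq_integral_abs_det_fderiv_smul (volume : Measure E)
      (f := fun x => x + t • g x) (f' := fun x => 1 + t • fderiv ℝ g x) measurableSet_ball
      (fun x _ => ((hasFDerivAt_id x).add ((hder x).const_smul t)).hasFDerivWithinAt) hb.injOn
      (fun _ => (1 : ℝ))
    rw [hb.image_eq] at h1
    rw [← setIntegral_one_eq_measureReal, h1]
    refine setIntegral_congr_fun measurableSet_ball fun x hx => ?_
    have hle : ‖fderiv ℝ g x‖ ≤ K := (hder x).le_of_lipschitzOn
      (closedBall_mem_nhds_of_mem hx) hK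
    have hlt : ‖t • fderiv ℝ g x‖ < 1 := by
      rw [norm_smul, Real.norm_eq_abs, abs_of_nonneg ht]
      exact (mul_le_mul_of_nonneg_left hle ht).trans_lt htK'
    simp only [smul_eq_mul, mul_one]
    rw [abs_of_pos (det_one_add_pos hlt)]
  -- Differentiating `‖r‖² = R²` shows that the range of `Dr(x)` is orthogonal to `r x ≠ 0`; hence
  -- `Dr(x)` is not surjective.
  have hdet : ∀ x, (1 + fderiv ℝ g x).det = 0 := by
    intro x
    have h1 : 1 + fderiv ℝ g x = fderiv ℝ r x := by
      have : fderiv ℝ g x = fderiv ℝ r x - 1 :=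
        (((hr.differentiable one_ne_zero x).hasFDerivAt).sub (hasFDerivAt_id x)).fderiv
      rw [this]; abel
    have horth : ∀ u, inner ℝ (r x) (fderiv ℝ r x u) = 0 := by
      intro u
      have hrx := (hr.differentiable one_ne_zero x).hasFDerivAt
      have h2 := (hrx.inner ℝ hrx).unique
        ((hasFDerivAt_const (R ^ 2) x).congr_of_eventuallyEq
          (Filter.Eventually.of_forall fun y => by
            simp only [real_inner_self_eq_norm_sq, hnorm]))
      have h3 := congrArg (fun L : E →L[ℝ] ℝ => L u) h2
      simp [real_inner_comm] at h3
      linarith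
    rw [h1]
    by_contra hne
    have hu : IsUnit (LinearMap.det (fderiv ℝ r x : E →ₗ[ℝ] E)) := isUnit_iff_ne_zero.2 hne
    let e := LinearEquiv.ofIsUnitDet (f := (fderiv ℝ r x : E →ₗ[ℝ] E))
      (v := Module.finBasis ℝ E) (v' := Module.finBasis ℝ E)
      (by rwa [LinearMap.det_toMatrix])
    have h4 := horth (e.symm (r x))
    have h5 : fderiv ℝ r x (e.symm (r x)) = r x := e.apply_symm_apply (r x)
    rw [h5, real_inner_self_eq_norm_sq, hnorm] at h4
    exact hR.ne' (pow_eq_zero_iff two_ne_zero |>.1 h4)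
  obtain ⟨n, t, c, ht, hc⟩ := exists_det_one_add_eq_sum (E := E)
    (show (0 : ℝ) < 1 / (K + 1) by positivity)
  -- Taking `A = 0` in the interpolation identity shows that the weights sum to `1`. Hence the
  -- volume found at small times persists at time `1`, where the integrand is zero.
  have hsum : ∑ i ∈ Finset.range n, c i = 1 := by
    have := hc 0
    simpa [ContinuousLinearMap.det] using this.symm
  have hzero : volume.real (ball (0 : E) R) = 0 := by
    calc volume.real (ball (0 : E) R)
        = ∑ i ∈ Finset.range n, c i * volume.real (ball (0 : E) R) := by
          rw [← Finset.sum_mul, hsum, one_mul]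
      _ = ∑ i ∈ Finset.range n, ∫ x in ball (0 : E) R, c i * (1 + t i • fderiv ℝ g x).det :=
          Finset.sum_congr rfl fun i _ => by
            rw [integral_const_mul, hvol _ (ht i).1 (ht i).2]
      _ = ∫ x in ball (0 : E) R, ∑ i ∈ Finset.range n, c i * (1 + t i • fderiv ℝ g x).det :=
          (integral_finsetSum _ fun i _ => (hint (t i)).const_mul (c i)).symm
      _ = 0 := by simp_rw [← hc, hdet, integral_zero]
  exact (ENNReal.toReal_pos (measure_ball_pos _ _ hR).ne' measure_ball_lt_top.ne).ne' hzero

/-- A continuous vector field that is the identity outside of a ball has a zero. -/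
theorem exists_eq_zero_of_eq_id_outside_ball {R : ℝ} (hR : 0 < R) {v : E → E} (hv : Continuous v)
    (hid : ∀ x, R ≤ ‖x‖ → v x = x) : ∃ x, v x = 0 := by
  by_contra! hne
  have hf : Continuous fun x => x - v x := continuous_id.sub hv
  -- The error is less than `‖v x‖`, so `x - w x` stays nonzero; the support condition keeps it
  -- equal to `x` outside the ball. Normalising it gives a forbidden retraction.
  obtain ⟨w, hw, hdist, hsupp⟩ := hf.exists_contDiff_approx 1 hv.norm
    (fun x => norm_pos_iff.2 (hne x))
  have hw_ne : ∀ x, x - w x ≠ 0 := by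
    intro x hx
    have := hdist x
    rw [← sub_eq_zero.1 hx, dist_eq_norm, sub_sub_cancel] at this
    exact this.false
  have hw0 : ∀ x, R ≤ ‖x‖ → w x = 0 := by
    intro x hx
    by_contra h
    exact hsupp (Function.mem_support.2 h) (by simp [hid x hx])
  have hu : ContDiff ℝ 1 fun x => x - w x := contDiff_id.sub hw
  refine not_contDiff_retraction_sphere hR
    (r := fun x => (R * ‖x - w x‖⁻¹) • (x - w x)) ?_ ?_ ?_
  · exact (contDiff_const.mul ((hu.norm ℝ hw_ne).inv fun x => norm_ne_zero_iff.2 (hw_ne x))).smul hu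
  · intro x
    have := norm_pos_iff.2 (hw_ne x)
    rw [norm_smul, Real.norm_eq_abs, abs_of_pos (by positivity), mul_assoc,
      inv_mul_cancel₀ this.ne', mul_one]
  · intro x hx
    simp only [hw0 x hx.ge, sub_zero, hx, mul_inv_cancel₀ hR.ne', one_smul]

end Brouwer

/-- Brouwer's fixed point theorem for bounded continuous maps of a finite-dimensional space. -/
theorem exists_fixedPoint_of_bounded {X : Type*} [NormedAddCommGroup X] [NormedSpace ℝ X]
    [FiniteDimensional ℝ X] {f : X → X} (hf : Continuous f) {C : ℝ} (hC : ∀ x, ‖f x‖ ≤ C) :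
    ∃ x, f x = x := by
  let e : X ≃L[ℝ] EuclideanSpace ℝ (Fin (Module.finrank ℝ X)) := toEuclidean
  let h := fun y => e (f (e.symm y))
  have hh : Continuous h := by fun_prop
  let L : ℝ := ‖(e : X →L[ℝ] EuclideanSpace ℝ (Fin (Module.finrank ℝ X)))‖ * C
  have hL : ∀ y, ‖h y‖ ≤ L := fun y =>
    ((e : X →L[ℝ] EuclideanSpace ℝ (Fin (Module.finrank ℝ X))).le_opNorm _).trans
      (mul_le_mul_of_nonneg_left (hC _) (norm_nonneg _))
  have hL0 : 0 ≤ L := (norm_nonneg _).trans (hL 0)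
  -- The cutoff is `1` up to radius `L + 1` and `0` from `L + 2` on. A zero of `y - χ y • h y` has
  -- norm at most `L`, where the cutoff is inactive.
  let χ : EuclideanSpace ℝ (Fin (Module.finrank ℝ X)) → ℝ := fun y => max 0 (min 1 (L + 2 - ‖y‖))
  have hχ : Continuous χ := by fun_prop
  have hχ0 : ∀ y, 0 ≤ χ y := fun y => le_max_left _ _
  have hχ1 : ∀ y, χ y ≤ 1 := fun y => max_le zero_le_one (min_le_left _ _)
  obtain ⟨y, hy⟩ := exists_eq_zero_of_eq_id_outside_ball (show 0 < L + 2 by linarith)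
    (v := fun y => y - χ y • h y) (continuous_id.sub (hχ.smul hh)) (fun y hy => by
      have : χ y = 0 := max_eq_left ((min_le_right _ _).trans (by linarith))
      simp [this])
  have hy' : y = χ y • h y := sub_eq_zero.1 hy
  have hyL : ‖y‖ ≤ L := by
    rw [hy', norm_smul, Real.norm_eq_abs, abs_of_nonneg (hχ0 y)]
    exact (mul_le_of_le_one_left (norm_nonneg _) (hχ1 y)).trans (hL y)
  have hχy : χ y = 1 := by
    simp only [χ]
    rw [min_eq_left (by linarith), max_eq_right zero_le_one]
  rw [hχy, one_smul] at hy'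
  refine ⟨e.symm y, ?_⟩
  rw [ContinuousLinearEquiv.eq_symm_apply]
  exact hy'.symm

/-! ### Radau polynomials: differential equation, uniform bound, moments -/

section Radau

open Polynomial

/-- The coefficients of the polynomial `₂F₁(-N, N; 1; X)`. -/
noncomputable def radauCoeff (N : ℕ) : ℕ → ℝ
  | 0 => 1
  | j + 1 => radauCoeff N j * ((j : ℝ) ^ 2 - (N : ℝ) ^ 2) / ((j : ℝ) + 1) ^ 2

theorem radauCoeff_eq_zero (N : ℕ) : ∀ j, N < j → radauCoeff N j = 0 := by
  intro j hj
  induction j, hj using Nat.le_induction with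
  | base => simp [radauCoeff]
  | succ j _ ih => simp [radauCoeff, ih]

/-- The Radau polynomial on `[0, 1]` of degree `N` with value `1` at `0`. -/
noncomputable def radau (N : ℕ) : ℝ[X] := ∑ j ∈ Finset.range (N + 1), C (radauCoeff N j) * X ^ j

theorem coeff_radau (N j : ℕ) : (radau N).coeff j = radauCoeff N j := by
  simp only [radau, finsetSum_coeff, coeff_C_mul_X_pow]
  rcases lt_or_ge N j with h | h
  · rw [radauCoeff_eq_zero N j h]
    exact Finset.sum_eq_zero fun i hi => if_neg (by have := Finset.mem_range.1 hi; omega)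
  · rw [Finset.sum_ite_eq, if_pos (Finset.mem_range.2 (by omega))]

theorem natDegree_radau_le (N : ℕ) : (radau N).natDegree ≤ N :=
  natDegree_le_iff_coeff_eq_zero.2 fun j hj => by rw [coeff_radau, radauCoeff_eq_zero N j hj]

/-- This is the hypergeometric equation in divergence form, equivalent to the coefficient recursion.
At `X = 1` it forces the root there. -/
theorem radau_ode (N : ℕ) :
    (1 - X) * derivative (X * derivative (radau N)) = -(C ((N : ℝ) ^ 2) * radau N) := by
  have hq : ∀ n, (derivative (X * derivative (radau N))).coeff n
      = ((n : ℝ) ^ 2 - (N : ℝ) ^ 2) * radauCoeff N n := by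
    intro n
    have hn : ((n : ℝ) + 1) ≠ 0 := by positivity
    rw [coeff_derivative, coeff_X_mul, coeff_derivative, coeff_radau, radauCoeff]
    field_simp
  ext n
  rw [sub_mul, one_mul, coeff_sub, coeff_neg, coeff_C_mul, coeff_radau, hq]
  cases n with
  | zero => simp
  | succ n =>
    have hn : ((n : ℝ) + 1) ≠ 0 := by positivity
    rw [coeff_X_mul, hq, radauCoeff]
    push_cast
    field_simp
    ring

theorem radau_ode' (N : ℕ) :
    (1 - X) * (derivative (radau N) + X * derivative (derivative (radau N)))
      = -(C ((N : ℝ) ^ 2) * radau N) := by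
  rw [← radau_ode, derivative_mul, derivative_X, one_mul]

theorem radau_eval_zero (N : ℕ) : (radau N).eval 0 = 1 := by
  rw [← coeff_zero_eq_eval_zero, coeff_radau, radauCoeff]

theorem radau_eval_one {N : ℕ} (hN : N ≠ 0) : (radau N).eval 1 = 0 := by
  have h := congrArg (eval 1) (radau_ode N)
  have hN' : (N : ℝ) ≠ 0 := Nat.cast_ne_zero.2 hN
  simpa [hN'] using h

/-- A Sonin-type argument: `S = N² ρ² + X (1 - X) ρ'²` dominates `N² ρ²` on the unit interval,
equals `N²` at `0`, and is decreasing because the differential equation gives `S' = -ρ'²`. -/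
theorem abs_radau_eval_le_one {N : ℕ} (hN : N ≠ 0) {s : ℝ} (hs : s ∈ Icc (0 : ℝ) 1) :
    |(radau N).eval s| ≤ 1 := by
  have hN' : (N : ℝ) ≠ 0 := Nat.cast_ne_zero.2 hN
  let S : ℝ[X] := C ((N : ℝ) ^ 2) * radau N ^ 2 + X * (1 - X) * derivative (radau N) ^ 2
  have hS : derivative S = -(derivative (radau N) ^ 2) := by
    simp only [S, derivative_add, derivative_mul, derivative_C, derivative_pow, derivative_X,
      derivative_sub, derivative_one]
    simp only [Nat.cast_ofNat, map_ofNat]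
    linear_combination (2 * derivative (radau N)) * radau_ode' N
  have hanti : AntitoneOn (fun x => S.eval x) (Icc 0 1) := by
    refine antitoneOn_of_deriv_nonpos (convex_Icc 0 1) S.continuous.continuousOn
      S.differentiable.differentiableOn fun x _ => ?_
    rw [Polynomial.deriv, hS]
    simp only [eval_neg, eval_pow]
    nlinarith [sq_nonneg (eval x (derivative (radau N)))]
  have h := hanti ⟨le_refl _, zero_le_one⟩ hs hs.1
  simp only [S, eval_add, eval_mul, eval_C, eval_pow, eval_X, eval_sub, eval_one,
    radau_eval_zero] at h
  have h1 : 0 ≤ s * (1 - s) * eval s (derivative (radau N)) ^ 2 :=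
    mul_nonneg (mul_nonneg hs.1 (by linarith [hs.2])) (sq_nonneg _)
  have hN2 : (0 : ℝ) < (N : ℝ) ^ 2 := by positivity
  have h2 : (N : ℝ) ^ 2 * eval s (radau N) ^ 2 ≤ (N : ℝ) ^ 2 * 1 := by linarith
  exact (sq_le_one_iff_abs_le_one _).1 (le_of_mul_le_mul_left h2 hN2)

theorem integral_eval_derivative (p : ℝ[X]) :
    ∫ s in (0 : ℝ)..1, (derivative p).eval s = p.eval 1 - p.eval 0 :=
  intervalIntegral.integral_eq_sub_of_hasDerivAt (fun x _ => p.hasDerivAt x)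
    ((derivative p).continuous.intervalIntegrable _ _)

/-- The differential equation yields a two-term recursion between consecutive moments, obtained by
integrating the derivative of `Φ`, which vanishes at both endpoints. The moment `-1` at `j = 0` does
not propagate because its coefficient contains the factor `j`. -/
theorem integral_derivative_radau_mul_pow {N : ℕ} :
    ∀ j, j < N → ∫ s in (0 : ℝ)..1, (derivative (radau N)).eval s * s ^ j
      = if j = 0 then -1 else 0 := by
  intro j hj
  have hN : N ≠ 0 := by omega
  induction j with
  | zero =>
    simp only [pow_zero, mul_one, if_true]
    rw [integral_eval_derivative, radau_eval_zero, radau_eval_one hN, zero_sub]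
  | succ j ih =>
    rw [if_neg (Nat.succ_ne_zero j)]
    have ih' := ih (by omega)
    let Φ : ℝ[X] := C ((j : ℝ) + 1) * ((1 - X) * X ^ (j + 1) * derivative (radau N))
      + C ((N : ℝ) ^ 2) * (radau N * X ^ (j + 1))
    have hΦ : derivative Φ = C (((j : ℝ) + 1) * j) * (derivative (radau N) * X ^ j)
        + C ((N : ℝ) ^ 2 - ((j : ℝ) + 1) ^ 2) * (derivative (radau N) * X ^ (j + 1)) := by
      simp only [Φ, derivative_add, derivative_mul, derivative_C, derivative_X_pow, derivative_X,
        derivative_sub, derivative_one]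
      simp only [map_add, map_mul, map_sub, map_pow, map_natCast, map_one]
      have := radau_ode' N
      simp only [map_pow, map_natCast] at this
      simp only [Nat.cast_add, Nat.cast_one, Nat.add_sub_cancel]
      linear_combination (((j : ℝ[X]) + 1) * X ^ j) * this
    have h1 := integral_eval_derivative Φ
    have h2 : Φ.eval 1 - Φ.eval 0 = 0 := by simp [Φ, radau_eval_one hN]
    rw [h2, hΦ] at h1
    simp only [eval_add, eval_mul, eval_C, eval_pow, eval_X] at h1
    rw [intervalIntegral.integral_add
        (Continuous.intervalIntegrable (by fun_prop) _ _)
        (Continuous.intervalIntegrable (by fun_prop) _ _),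
      intervalIntegral.integral_const_mul, intervalIntegral.integral_const_mul, ih'] at h1
    have h3 : ((j : ℝ) + 1) * j * (if j = 0 then -1 else 0) = 0 := by
      split_ifs with h
      · simp [h]
      · simp
    rw [h3, zero_add] at h1
    have h4 : (N : ℝ) ^ 2 - ((j : ℝ) + 1) ^ 2 ≠ 0 := by
      have : ((j : ℝ) + 1) < N := by exact_mod_cast hj
      nlinarith [(Nat.cast_nonneg j : (0 : ℝ) ≤ j)]
    exact (mul_eq_zero.1 h1).resolve_left h4

end Radau

/-! ### Polynomials with vector coefficients -/

section VectorPolynomials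

variable {E : Type*} [NormedAddCommGroup E] [NormedSpace ℝ E]

/-- The polynomial function with given vector coefficients, as a linear map of the coefficients. -/
def polyFun (r : ℕ) : (Fin (r + 1) → E) →ₗ[ℝ] ℝ → E where
  toFun x t := ∑ i : Fin (r + 1), t ^ (i : ℕ) • x i
  map_add' x y := by ext t; simp [Finset.sum_add_distrib]
  map_smul' c x := by
    ext t
    simp only [Pi.smul_apply, RingHom.id_apply, Finset.smul_sum]
    exact Finset.sum_congr rfl fun i _ => smul_comm _ _ _

theorem polyFun_apply {r : ℕ} (x : Fin (r + 1) → E) (t : ℝ) :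
    polyFun r x t = ∑ i : Fin (r + 1), t ^ (i : ℕ) • x i := rfl

/-- `f` is a polynomial function of degree at most `r`. -/
def IsPoly (r : ℕ) (f : ℝ → E) : Prop := ∃ x : Fin (r + 1) → E, f = polyFun r x

theorem isPoly_polyFun {r : ℕ} (x : Fin (r + 1) → E) : IsPoly r (polyFun r x) := ⟨x, rfl⟩

theorem polyFun_zero {r : ℕ} (x : Fin (r + 1) → E) : polyFun r x 0 = x 0 := by
  rw [polyFun_apply, Fin.sum_univ_succ]
  simp

theorem continuous_polyFun_uncurry (r : ℕ) :
    Continuous fun p : (Fin (r + 1) → E) × ℝ => polyFun r p.1 p.2 := by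
  simp only [polyFun_apply]
  fun_prop

theorem IsPoly.continuous {r : ℕ} {f : ℝ → E} (hf : IsPoly r f) : Continuous f := by
  obtain ⟨x, rfl⟩ := hf
  exact (continuous_polyFun_uncurry r).comp (by fun_prop : Continuous fun t : ℝ => (x, t))

theorem IsPoly.add {r : ℕ} {f g : ℝ → E} (hf : IsPoly r f) (hg : IsPoly r g) :
    IsPoly r (fun t => f t + g t) := by
  obtain ⟨x, rfl⟩ := hf
  obtain ⟨y, rfl⟩ := hg
  exact ⟨x + y, by rw [map_add]; rfl⟩

theorem IsPoly.sub {r : ℕ} {f g : ℝ → E} (hf : IsPoly r f) (hg : IsPoly r g) :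
    IsPoly r (fun t => f t - g t) := by
  obtain ⟨x, rfl⟩ := hf
  obtain ⟨y, rfl⟩ := hg
  exact ⟨x - y, by rw [map_sub]; rfl⟩

theorem IsPoly.sum {r : ℕ} {ι : Type*} (s : Finset ι) {f : ι → ℝ → E}
    (hf : ∀ i ∈ s, IsPoly r (f i)) : IsPoly r (fun t => ∑ i ∈ s, f i t) := by
  classical
  induction s using Finset.induction_on with
  | empty => exact ⟨0, by rw [map_zero]; ext; simp⟩
  | insert i s his ih =>
    simp only [Finset.sum_insert his]
    exact (hf i (Finset.mem_insert_self i s)).add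
      (ih fun j hj => hf j (Finset.mem_insert_of_mem hj))

theorem isPoly_eval_smul {r : ℕ} {p : Polynomial ℝ} (hp : p.natDegree ≤ r) (v : E) :
    IsPoly r (fun t => p.eval t • v) := by
  refine ⟨fun i => p.coeff i • v, funext fun t => ?_⟩
  rw [polyFun_apply, Polynomial.eval_eq_sum_range' (Nat.lt_succ_of_le hp), Finset.sum_smul,
    ← Fin.sum_univ_eq_sum_range (fun i => (p.coeff i * t ^ i) • v)]
  exact Finset.sum_congr rfl fun i _ => by rw [smul_smul, mul_comm]

theorem isPoly_const (r : ℕ) (v : E) : IsPoly r (fun _ => v) := by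
  simpa using isPoly_eval_smul (r := r) (p := 1) (by simp) v

theorem IsPoly.comp_affine {r : ℕ} {f : ℝ → E} (hf : IsPoly r f) (α β : ℝ) :
    IsPoly r (fun t => f (α + β * t)) := by
  obtain ⟨x, rfl⟩ := hf
  refine IsPoly.sum (f := fun (i : Fin (r + 1)) t => (α + β * t) ^ (i : ℕ) • x i) Finset.univ fun i _ => ?_
  have h := isPoly_eval_smul (r := r)
    (p := (Polynomial.C α + Polynomial.C β * Polynomial.X) ^ (i : ℕ)) ?_ (x i)
  · simpa using h
  · refine (Polynomial.natDegree_pow_le).trans ?_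
    have h1 : (Polynomial.C α + Polynomial.C β * Polynomial.X).natDegree ≤ 1 := by compute_degree
    have h2 := Nat.mul_le_mul_left (i : ℕ) h1
    have := i.2
    omega

/-- The derivative of `polyFun r x`. -/
def polyDeriv (r : ℕ) : (Fin (r + 1) → E) →ₗ[ℝ] ℝ → E where
  toFun x t := ∑ i : Fin (r + 1), ((i : ℕ) * t ^ ((i : ℕ) - 1)) • x i
  map_add' x y := by ext t; simp [Finset.sum_add_distrib]
  map_smul' c x := by
    ext t
    simp only [Pi.smul_apply, RingHom.id_apply, Finset.smul_sum]
    exact Finset.sum_congr rfl fun i _ => smul_comm _ _ _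

theorem hasDerivAt_polyFun {r : ℕ} (x : Fin (r + 1) → E) (t : ℝ) :
    HasDerivAt (polyFun r x) (polyDeriv r x t) t :=
  HasDerivAt.fun_sum (u := Finset.univ) fun (i : Fin (r + 1)) _ =>
    (hasDerivAt_pow (i : ℕ) t).smul_const (x i)

theorem isPoly_polyDeriv {r : ℕ} (x : Fin (r + 1) → E) : IsPoly r (polyDeriv r x) := by
  refine IsPoly.sum (f := fun (i : Fin (r + 1)) t => ((i : ℕ) * t ^ ((i : ℕ) - 1)) • x i)
    Finset.univ fun i _ => ?_
  have h := isPoly_eval_smul (r := r)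
    (p := Polynomial.C ((i : ℕ) : ℝ) * Polynomial.X ^ ((i : ℕ) - 1)) ?_ (x i)
  · simpa using h
  · refine (Polynomial.natDegree_C_mul_X_pow_le _ _).trans ?_
    have := i.2
    omega

/-- The antiderivative of `polyFun r x` that vanishes at `0`. -/
noncomputable def polyPrim (r : ℕ) (x : Fin (r + 1) → E) (t : ℝ) : E :=
  ∑ i : Fin (r + 1), (t ^ ((i : ℕ) + 1) / ((i : ℕ) + 1)) • x i

theorem hasDerivAt_polyPrim {r : ℕ} (x : Fin (r + 1) → E) (t : ℝ) :
    HasDerivAt (polyPrim r x) (polyFun r x t) t := by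
  refine HasDerivAt.fun_sum fun i _ => ?_
  have h := ((hasDerivAt_pow ((i : ℕ) + 1) t).div_const (((i : ℕ) : ℝ) + 1)).smul_const (x i)
  have hi : (((i : ℕ) : ℝ) + 1) ≠ 0 := by positivity
  convert h using 2
  push_cast [Nat.add_sub_cancel]
  field_simp

theorem isPoly_polyPrim {r : ℕ} (x : Fin (r + 1) → E) : IsPoly (r + 1) (polyPrim r x) := by
  refine IsPoly.sum (f := fun (i : Fin (r + 1)) t => (t ^ ((i : ℕ) + 1) / ((i : ℕ) + 1)) • x i)
    Finset.univ fun i _ => ?_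
  have h := isPoly_eval_smul (r := r + 1)
    (p := Polynomial.C (((i : ℕ) + 1 : ℝ)⁻¹) * Polynomial.X ^ ((i : ℕ) + 1)) ?_ (x i)
  · simpa [div_eq_inv_mul] using h
  · refine (Polynomial.natDegree_C_mul_X_pow_le _ _).trans ?_
    have := i.2
    omega

theorem polyPrim_zero {r : ℕ} (x : Fin (r + 1) → E) : polyPrim r x 0 = 0 := by
  simp [polyPrim]

theorem continuous_polyPrim_uncurry (r : ℕ) :
    Continuous fun p : (Fin (r + 1) → E) × ℝ => polyPrim r p.1 p.2 := by
  simp only [polyPrim]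
  fun_prop

/-- Each continuous functional turns the function into a scalar polynomial with infinitely many
roots, and functionals separate the coefficients. -/
theorem eq_zero_of_polyFun_eq_zero {r : ℕ} {x : Fin (r + 1) → E}
    (h : ∀ t ∈ Ioo (0 : ℝ) 1, polyFun r x t = 0) : x = 0 := by
  funext j
  refine (SeparatingDual.eq_zero_iff_forall_dual_eq_zero (R := ℝ) (x j)).2 fun φ => ?_
  let p : Polynomial ℝ := ∑ i : Fin (r + 1), Polynomial.C (φ (x i)) * Polynomial.X ^ (i : ℕ)
  have hp : p = 0 := by
    refine Polynomial.eq_zero_of_infinite_isRoot p ((Ioo_infinite zero_lt_one).mono fun t ht => ?_)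
    have h1 := congrArg φ (h t ht)
    rw [polyFun_apply, map_sum, map_zero] at h1
    change p.eval t = 0
    rw [← h1]
    simp only [p, Polynomial.eval_finsetSum]
    refine Finset.sum_congr rfl fun i _ => ?_
    rw [Polynomial.eval_mul, Polynomial.eval_C, Polynomial.eval_pow, Polynomial.eval_X, map_smul,
      smul_eq_mul, mul_comm]
  have h2 := congrArg (fun q => Polynomial.coeff q (j : ℕ)) hp
  simpa [p, Polynomial.finsetSum_coeff, Polynomial.coeff_C_mul_X_pow, Fin.val_inj] using h2

end VectorPolynomials

/-! ### A priori bounds and existence on the unit interval -/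

section ReferenceInterval

variable {E : Type*} [NormedAddCommGroup E] [InnerProductSpace ℝ E]

theorem intervalIntegrable_inner {u v : ℝ → E} (hu : Continuous u) (hv : Continuous v) (a b : ℝ) :
    IntervalIntegrable (fun s => inner ℝ (u s) (v s)) volume a b :=
  (hu.inner hv).intervalIntegrable a b

theorem integral_inner_le {h Z : ℝ → E} {m B : ℝ} (hh : Continuous h) (hZ : Continuous Z)
    (hm : ∀ s, ‖h s‖ ≤ m) (hB : ∀ s ∈ Icc (0 : ℝ) 1, ‖Z s‖ ≤ B) :
    ∫ s in (0 : ℝ)..1, inner ℝ (h s) (Z s) ≤ m * B := by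
  have hm0 : 0 ≤ m := (norm_nonneg _).trans (hm 0)
  calc ∫ s in (0 : ℝ)..1, inner ℝ (h s) (Z s) ≤ ∫ _ in (0 : ℝ)..1, m * B :=
        intervalIntegral.integral_mono_on zero_le_one (intervalIntegrable_inner hh hZ _ _)
          intervalIntegrable_const fun s hs => (real_inner_le_norm _ _).trans
            (mul_le_mul (hm s) (hB s hs) (norm_nonneg _) hm0)
    _ = m * B := by simp

/-- If `Z` is tested by itself against a right-hand side bounded by `m`, then its `L¹` norm over
the unit interval is at most `m`. -/
theorem integral_norm_le_of_integral_inner_self {h Z : ℝ → E} {m : ℝ} (hh : Continuous h)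
    (hZ : Continuous Z) (hm : ∀ s, ‖h s‖ ≤ m)
    (heq : ∫ s in (0 : ℝ)..1, inner ℝ (Z s) (Z s) = ∫ s in (0 : ℝ)..1, inner ℝ (h s) (Z s)) :
    ∫ s in (0 : ℝ)..1, ‖Z s‖ ≤ m := by
  set I := ∫ s in (0 : ℝ)..1, ‖Z s‖ with hI
  have hI0 : 0 ≤ I := intervalIntegral.integral_nonneg zero_le_one fun s _ => norm_nonneg _
  have hm0 : 0 ≤ m := (norm_nonneg _).trans (hm 0)
  have h1 : ∫ s in (0 : ℝ)..1, inner ℝ (h s) (Z s) ≤ m * I := by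
    rw [hI, ← intervalIntegral.integral_const_mul]
    exact intervalIntegral.integral_mono_on zero_le_one (intervalIntegrable_inner hh hZ _ _)
      ((continuous_const.mul hZ.norm).intervalIntegrable _ _) fun s _ =>
        (real_inner_le_norm _ _).trans (mul_le_mul_of_nonneg_right (hm s) (norm_nonneg _))
  -- Integrating `(‖Z‖ - I)² ≥ 0` gives `I² ≤ ∫ ‖Z‖²`, the Cauchy–Schwarz inequality needed here.
  have h2 : 0 ≤ ∫ s in (0 : ℝ)..1, (inner ℝ (Z s) (Z s) - 2 * I * ‖Z s‖ + I ^ 2) :=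
    intervalIntegral.integral_nonneg zero_le_one fun s _ => by
      rw [real_inner_self_eq_norm_sq]
      nlinarith [sq_nonneg (‖Z s‖ - I)]
  have hc1 : Continuous fun s => inner ℝ (Z s) (Z s) := hZ.inner hZ
  have hc2 : Continuous fun s => 2 * I * ‖Z s‖ := continuous_const.mul hZ.norm
  rw [intervalIntegral.integral_add ((hc1.fun_sub hc2).intervalIntegrable _ _)
      intervalIntegrable_const,
    intervalIntegral.integral_sub (hc1.intervalIntegrable _ _) (hc2.intervalIntegrable _ _),
    intervalIntegral.integral_const_mul, ← hI, heq] at h2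
  simp only [intervalIntegral.integral_const, sub_zero, one_smul] at h2
  by_contra! hlt
  nlinarith

theorem norm_le_of_hasDerivAt [CompleteSpace E] {Y Z : ℝ → E} {m : ℝ} (hZ : Continuous Z)
    (hY : ∀ s, HasDerivAt Y (Z s) s) (hY0 : Y 0 = 0) (hm : ∫ s in (0 : ℝ)..1, ‖Z s‖ ≤ m) {s : ℝ}
    (hs : s ∈ Icc (0 : ℝ) 1) : ‖Y s‖ ≤ m := by
  have h1 : Y s = ∫ σ in (0 : ℝ)..s, Z σ := by
    rw [intervalIntegral.integral_eq_sub_of_hasDerivAt (fun x _ => hY x)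
      (hZ.intervalIntegrable _ _), hY0, sub_zero]
  rw [h1]
  refine (intervalIntegral.norm_integral_le_integral_norm hs.1).trans (le_trans ?_ hm)
  exact intervalIntegral.integral_mono_interval le_rfl hs.1 hs.2
    (Filter.Eventually.of_forall fun x => norm_nonneg _) (hZ.norm.intervalIntegrable _ _)

/-- This turns the jump term of dG into an integral that can be absorbed in the derivative. -/
theorem integral_inner_radau {r : ℕ} (w : E) {V : ℝ → E} (hV : IsPoly r V) :
    ∫ s in (0 : ℝ)..1, inner ℝ ((Polynomial.derivative (radau (r + 1))).eval s • w) (V s)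
      = -inner ℝ w (V 0) := by
  obtain ⟨x, rfl⟩ := hV
  have h1 : ∀ s : ℝ, inner ℝ ((Polynomial.derivative (radau (r + 1))).eval s • w) (polyFun r x s)
      = ∑ i : Fin (r + 1), (Polynomial.derivative (radau (r + 1))).eval s * s ^ (i : ℕ)
        * inner ℝ w (x i) := by
    intro s
    rw [polyFun_apply, inner_sum]
    refine Finset.sum_congr rfl fun i _ => ?_
    rw [real_inner_smul_left, real_inner_smul_right, mul_assoc]
  simp_rw [h1]
  rw [intervalIntegral.integral_finsetSum fun i _ =>
    Continuous.intervalIntegrable (by fun_prop) _ _]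
  simp_rw [intervalIntegral.integral_mul_const]
  rw [Fin.sum_univ_succ, Finset.sum_eq_zero]
  · rw [integral_derivative_radau_mul_pow _ (by simp), polyFun_zero]
    simp
  · intro i _
    rw [integral_derivative_radau_mul_pow _ (Fin.is_lt _), if_neg (by simp), zero_mul]

/-- The a priori bound for the continuous Galerkin method on the unit interval. -/
theorem norm_le_of_cg [CompleteSpace E] {r : ℕ} {W Z h : ℝ → E} {m : ℝ} (hZ : IsPoly r Z)
    (hW : ∀ s, HasDerivAt W (Z s) s) (hW0 : W 0 = 0) (hh : Continuous h) (hm : ∀ s, ‖h s‖ ≤ m)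
    (heq : ∀ V, IsPoly r V →
      ∫ s in (0 : ℝ)..1, inner ℝ (Z s) (V s) = ∫ s in (0 : ℝ)..1, inner ℝ (h s) (V s))
    {s : ℝ} (hs : s ∈ Icc (0 : ℝ) 1) : ‖W s‖ ≤ m :=
  norm_le_of_hasDerivAt hZ.continuous hW hW0
    (integral_norm_le_of_integral_inner_self hh hZ.continuous hm (heq Z hZ)) hs

/-- The a priori bound for the discontinuous Galerkin method on the unit interval; the constant
does not depend on the degree. -/
theorem norm_le_of_dg [CompleteSpace E] {r : ℕ} {W Z h : ℝ → E} {m : ℝ} (hWp : IsPoly r W)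
    (hZ : IsPoly r Z) (hW : ∀ s, HasDerivAt W (Z s) s) (hh : Continuous h) (hm : ∀ s, ‖h s‖ ≤ m)
    (heq : ∀ V, IsPoly r V →
      (∫ s in (0 : ℝ)..1, inner ℝ (Z s) (V s)) + inner ℝ (W 0) (V 0)
        = ∫ s in (0 : ℝ)..1, inner ℝ (h s) (V s))
    {s : ℝ} (hs : s ∈ Icc (0 : ℝ) 1) : ‖W s‖ ≤ 4 * m := by
  have hm0 : 0 ≤ m := (norm_nonneg _).trans (hm 0)
  -- Degree `r + 1` is the right one: `ρ'` has degree at most `r`, hence is an admissible test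
  -- function, and its moments are known for all powers up to `r`.
  let ρ := radau (r + 1)
  have hρ' : IsPoly r fun s => (Polynomial.derivative ρ).eval s • W 0 :=
    isPoly_eval_smul ((Polynomial.natDegree_derivative_le _).trans
      (Nat.sub_le_of_le_add (natDegree_radau_le (r + 1)))) _
  have hY' := hZ.sub hρ'
  have hYd : ∀ s, HasDerivAt (fun s => W s - ρ.eval s • W 0)
      (Z s - (Polynomial.derivative ρ).eval s • W 0) s := fun s =>
    (hW s).sub ((ρ.hasDerivAt s).smul_const (W 0))
  have hYeq : ∀ V, IsPoly r V →
      ∫ s in (0 : ℝ)..1, inner ℝ (Z s - (Polynomial.derivative ρ).eval s • W 0) (V s)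
        = ∫ s in (0 : ℝ)..1, inner ℝ (h s) (V s) := by
    intro V hV
    rw [← heq V hV]
    simp_rw [inner_sub_left]
    rw [intervalIntegral.integral_sub
      (intervalIntegrable_inner hZ.continuous hV.continuous _ _)
      (intervalIntegrable_inner hρ'.continuous hV.continuous _ _), integral_inner_radau _ hV,
      sub_neg_eq_add]
  have hWle : ∀ s ∈ Icc (0 : ℝ) 1, ‖W s‖ ≤ m + ‖W 0‖ := by
    intro s hs
    have h1 := norm_le_of_cg hY' hYd (by simp [ρ, radau_eval_zero]) hh hm hYeq hs
    have h2 : ‖ρ.eval s • W 0‖ ≤ ‖W 0‖ := by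
      rw [norm_smul]
      exact mul_le_of_le_one_left (norm_nonneg _) (abs_radau_eval_le_one (by simp) hs)
    have h3 := norm_add_le (W s - ρ.eval s • W 0) (ρ.eval s • W 0)
    rw [sub_add_cancel] at h3
    linarith
  have hen : ∫ s in (0 : ℝ)..1, inner ℝ (Z s) (W s) = (‖W 1‖ ^ 2 - ‖W 0‖ ^ 2) / 2 := by
    have hd : ∀ s, HasDerivAt (fun s => ‖W s‖ ^ 2 / 2) (inner ℝ (Z s) (W s)) s := by
      intro s
      refine ((hW s).norm_sq.div_const 2).congr_deriv ?_
      rw [real_inner_comm]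
      ring
    rw [intervalIntegral.integral_eq_sub_of_hasDerivAt (fun x _ => hd x)
      (intervalIntegrable_inner hZ.continuous hWp.continuous _ _)]
    ring
  have h1 := heq W hWp
  rw [hen, real_inner_self_eq_norm_sq] at h1
  have h2 := integral_inner_le hh hWp.continuous hm hWle
  -- Testing with `W` gives `(‖W 1‖² + ‖W 0‖²) / 2 ≤ m (m + ‖W 0‖)`, which fails if `‖W 0‖ > 3 m`.
  have h3 : ‖W 0‖ ≤ 3 * m := by
    by_contra! hlt
    nlinarith [sq_nonneg ‖W 1‖, norm_nonneg (W 0)]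
  linarith [hWle s hs]

/-- Solvability of a nonlinear variational problem on a finite-dimensional space whose linear part
is nondegenerate and whose right-hand side is bounded. -/
theorem exists_variational_solution {X : Type*} [NormedAddCommGroup X] [NormedSpace ℝ X]
    [FiniteDimensional ℝ X] (D P : X →ₗ[ℝ] ℝ → E) (Q : X →ₗ[ℝ] E) (W : X → ℝ → E)
    (hD : ∀ x, Continuous (D x)) (hP : ∀ x, Continuous (P x)) (hW : Continuous (Function.uncurry W))
    (hinj : ∀ x, (∀ y, (∫ s in (0 : ℝ)..1, inner ℝ (D x s) (P y s)) + inner ℝ (Q x) (P y 0) = 0) →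
      x = 0)
    {g : ℝ × E → E} (hg : Continuous g) {m : ℝ} (hm : ∀ p, ‖g p‖ ≤ m) :
    ∃ x, ∀ y, (∫ s in (0 : ℝ)..1, inner ℝ (D x s) (P y s)) + inner ℝ (Q x) (P y 0)
      = ∫ s in (0 : ℝ)..1, inner ℝ (g (s, W x s)) (P y s) := by
  have hgW : Continuous fun p : X × ℝ => g (p.2, W p.1 p.2) :=
    hg.comp (continuous_snd.prodMk hW)
  have hgx : ∀ x, Continuous fun s => g (s, W x s) := fun x =>
    hgW.comp (by fun_prop : Continuous fun s : ℝ => (x, s))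
  let A : X →ₗ[ℝ] X →ₗ[ℝ] ℝ := LinearMap.mk₂ ℝ
    (fun x y => (∫ s in (0 : ℝ)..1, inner ℝ (D x s) (P y s)) + inner ℝ (Q x) (P y 0))
    (fun x x' y => by
      simp only [map_add, Pi.add_apply, inner_add_left]
      rw [intervalIntegral.integral_add (intervalIntegrable_inner (hD x) (hP y) _ _)
        (intervalIntegrable_inner (hD x') (hP y) _ _)]
      ring)
    (fun c x y => by
      simp only [map_smul, Pi.smul_apply, real_inner_smul_left,
        intervalIntegral.integral_const_mul, smul_eq_mul]
      ring)
    (fun x y y' => by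
      simp only [map_add, Pi.add_apply, inner_add_right]
      rw [intervalIntegral.integral_add (intervalIntegrable_inner (hD x) (hP y) _ _)
        (intervalIntegrable_inner (hD x) (hP y') _ _)]
      ring)
    (fun c x y => by
      simp only [map_smul, Pi.smul_apply, real_inner_smul_right,
        intervalIntegral.integral_const_mul, smul_eq_mul]
      ring)
  let G : X → X →ₗ[ℝ] ℝ := fun x =>
    { toFun := fun y => ∫ s in (0 : ℝ)..1, inner ℝ (g (s, W x s)) (P y s)
      map_add' := fun y y' => by
        simp only [map_add, Pi.add_apply, inner_add_right]
        rw [intervalIntegral.integral_add (intervalIntegrable_inner (hgx x) (hP y) _ _)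
          (intervalIntegrable_inner (hgx x) (hP y') _ _)]
      map_smul' := fun c y => by
        simp only [map_smul, Pi.smul_apply, real_inner_smul_right,
          intervalIntegral.integral_const_mul, smul_eq_mul, RingHom.id_apply] }
  let b := Module.finBasis ℝ X
  -- Testing against a basis makes the linear part an injective, hence invertible, square system
  -- `e`; a solution is a fixed point of the bounded map `e⁻¹ ∘ N`.
  let L : X →ₗ[ℝ] Fin (Module.finrank ℝ X) → ℝ := LinearMap.pi fun i => A.flip (b i)
  have hL : Function.Injective L := by
    refine (injective_iff_map_eq_zero L).2 fun x hx => hinj x fun y => ?_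
    have hA : A x = 0 := b.ext fun i => congrFun hx i
    exact LinearMap.congr_fun hA y
  let e := (L.linearEquivOfInjective hL (by simp)).toContinuousLinearEquiv
  let N : X → Fin (Module.finrank ℝ X) → ℝ := fun x i => G x (b i)
  have hN : Continuous N := continuous_pi fun i => by
    refine intervalIntegral.continuous_parametric_intervalIntegral_of_continuous' ?_ 0 1
    exact hgW.inner ((hP (b i)).comp continuous_snd)
  have hbound : ∀ i, ∃ C, ∀ x, ‖N x i‖ ≤ C := by
    intro i
    obtain ⟨C, hC⟩ := (isCompact_Icc (a := (0 : ℝ)) (b := 1)).exists_bound_of_continuousOn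
      (hP (b i)).continuousOn
    refine ⟨m * C, fun x => abs_le.2 ⟨?_, ?_⟩⟩
    · have h1 := integral_inner_le (hgx x).fun_neg (hP (b i)) (m := m) (B := C)
        (fun s => by rw [norm_neg]; exact hm _) hC
      simp only [inner_neg_left, intervalIntegral.integral_neg] at h1
      exact neg_le_of_neg_le h1
    · exact integral_inner_le (hgx x) (hP (b i)) (fun s => hm _) hC
  choose C hC using hbound
  let K : ℝ := ∑ i, |C i|
  have hK : ∀ x, ‖N x‖ ≤ K := fun x =>
    (pi_norm_le_iff_of_nonneg (Finset.sum_nonneg fun i _ => abs_nonneg _)).2 fun i =>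
      ((hC i x).trans (le_abs_self _)).trans
        (Finset.single_le_sum (f := fun i => |C i|) (fun i _ => abs_nonneg _) (Finset.mem_univ i))
  obtain ⟨x, hx⟩ := exists_fixedPoint_of_bounded (f := fun x => e.symm (N x))
    (e.symm.continuous.comp hN)
    (C := ‖(e.symm : (Fin (Module.finrank ℝ X) → ℝ) →L[ℝ] X)‖ * K)
    (fun x => ((e.symm : (Fin (Module.finrank ℝ X) → ℝ) →L[ℝ] X).le_opNorm _).trans
      (mul_le_mul_of_nonneg_left (hK x) (norm_nonneg _)))
  have hx' : N x = e x := (e.symm_apply_eq).1 hx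
  have hAG : A x = G x := b.ext fun i => (congrFun hx' i).symm
  exact ⟨x, fun y => LinearMap.congr_fun hAG y⟩

variable [FiniteDimensional ℝ E]

/-- The unknown is the derivative `Z`, so trial and test spaces coincide, and `W` is recovered as
the primitive vanishing at `0`. -/
theorem exists_cg_reference (r : ℕ) {g : ℝ × E → E} (hg : Continuous g) {m : ℝ}
    (hm : ∀ p, ‖g p‖ ≤ m) :
    ∃ W Z : ℝ → E, IsPoly (r + 1) W ∧ IsPoly r Z ∧ (∀ s, HasDerivAt W (Z s) s) ∧ W 0 = 0 ∧
      (∀ s ∈ Icc (0 : ℝ) 1, ‖W s‖ ≤ m) ∧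
      ∀ V, IsPoly r V → ∫ s in (0 : ℝ)..1, inner ℝ (Z s) (V s)
        = ∫ s in (0 : ℝ)..1, inner ℝ (g (s, W s)) (V s) := by
  have hc : ∀ x : Fin (r + 1) → E, Continuous (polyFun r x) := fun x =>
    (isPoly_polyFun x).continuous
  obtain ⟨x, hx⟩ := exists_variational_solution (polyFun r) (polyFun r)
    (0 : (Fin (r + 1) → E) →ₗ[ℝ] E) (polyPrim r) hc hc (continuous_polyPrim_uncurry r) (by
      intro x hx
      have hW : ∀ s ∈ Icc (0 : ℝ) 1, polyPrim r x s = 0 := fun s hs => by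
        refine norm_le_zero_iff.1 (norm_le_of_cg (h := fun _ => 0) (isPoly_polyFun x)
          (hasDerivAt_polyPrim x) (polyPrim_zero x) continuous_const (by simp) ?_ hs)
        rintro V ⟨y, rfl⟩
        simpa using hx y
      refine eq_zero_of_polyFun_eq_zero fun t ht => ?_
      refine (hasDerivAt_polyPrim x t).unique ((hasDerivAt_const t (0 : E)).congr_of_eventuallyEq ?_)
      filter_upwards [Icc_mem_nhds ht.1 ht.2] with s hs using hW s hs) hg hm
  have heq : ∀ V, IsPoly r V → ∫ s in (0 : ℝ)..1, inner ℝ (polyFun r x s) (V s)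
      = ∫ s in (0 : ℝ)..1, inner ℝ (g (s, polyPrim r x s)) (V s) := by
    rintro V ⟨y, rfl⟩
    simpa using hx y
  exact ⟨polyPrim r x, polyFun r x, isPoly_polyPrim x, isPoly_polyFun x, hasDerivAt_polyPrim x,
    polyPrim_zero x, fun s hs => norm_le_of_cg (isPoly_polyFun x) (hasDerivAt_polyPrim x)
      (polyPrim_zero x) (hg.comp (continuous_id.prodMk (isPoly_polyPrim x).continuous))
      (fun s => hm _) heq hs, heq⟩

theorem exists_dg_reference (r : ℕ) {g : ℝ × E → E} (hg : Continuous g) {m : ℝ}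
    (hm : ∀ p, ‖g p‖ ≤ m) :
    ∃ W Z : ℝ → E, IsPoly r W ∧ (∀ s, HasDerivAt W (Z s) s) ∧
      (∀ s ∈ Icc (0 : ℝ) 1, ‖W s‖ ≤ 4 * m) ∧
      ∀ V, IsPoly r V → (∫ s in (0 : ℝ)..1, inner ℝ (Z s) (V s)) + inner ℝ (W 0) (V 0)
        = ∫ s in (0 : ℝ)..1, inner ℝ (g (s, W s)) (V s) := by
  have hc : ∀ x : Fin (r + 1) → E, Continuous (polyFun r x) := fun x =>
    (isPoly_polyFun x).continuous
  obtain ⟨x, hx⟩ := exists_variational_solution (polyDeriv r) (polyFun r)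
    (LinearMap.proj 0 : (Fin (r + 1) → E) →ₗ[ℝ] E) (fun x => polyFun r x)
    (fun x => (isPoly_polyDeriv x).continuous) hc (continuous_polyFun_uncurry r) (by
      intro x hx
      refine eq_zero_of_polyFun_eq_zero fun t ht => norm_le_zero_iff.1 ?_
      refine (norm_le_of_dg (h := fun _ => 0) (m := 0) (isPoly_polyFun x) (isPoly_polyDeriv x)
        (hasDerivAt_polyFun x) continuous_const (by simp) ?_ ⟨ht.1.le, ht.2.le⟩).trans (by simp)
      rintro V ⟨y, rfl⟩
      simpa [polyFun_zero] using hx y) hg hm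
  have heq : ∀ V, IsPoly r V → (∫ s in (0 : ℝ)..1, inner ℝ (polyDeriv r x s) (V s))
      + inner ℝ (polyFun r x 0) (V 0)
      = ∫ s in (0 : ℝ)..1, inner ℝ (g (s, polyFun r x s)) (V s) := by
    rintro V ⟨y, rfl⟩
    rw [polyFun_zero x]
    exact hx y
  exact ⟨polyFun r x, polyDeriv r x, isPoly_polyFun x, hasDerivAt_polyFun x, fun s hs =>
    norm_le_of_dg (isPoly_polyFun x) (isPoly_polyDeriv x) (hasDerivAt_polyFun x)
      (hg.comp (continuous_id.prodMk (isPoly_polyFun x).continuous)) (fun s => hm _) heq hs, heq⟩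

end ReferenceInterval

/-! ### Truncation and transport back to the time interval -/

section Assembly

/-- After rescaling time to the unit interval and truncating the argument to the unit ball around
`u₀`, a continuous right-hand side becomes globally continuous and bounded. -/
theorem exists_truncation {E : Type*} [NormedAddCommGroup E] [NormedSpace ℝ E]
    [FiniteDimensional ℝ E] {T a : ℝ} (ha : 0 ≤ a) {f : ℝ → E → E}
    (hf : ContinuousOn (Function.uncurry f) (Icc 0 T ×ˢ univ)) (u₀ : E) :
    ∃ M : ℝ, 0 ≤ M ∧ ∀ k, 0 ≤ k → a + k ≤ T → ∃ g : ℝ × E → E, Continuous g ∧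
      (∀ p, ‖g p‖ ≤ k * M) ∧
      ∀ s ∈ Icc (0 : ℝ) 1, ∀ w : E, ‖w‖ ≤ 1 → g (s, w) = k • f (a + k * s) (u₀ + w) := by
  have := FiniteDimensional.proper_real E
  obtain ⟨M, hM⟩ := (isCompact_Icc.prod (isCompact_closedBall u₀ 1)).exists_bound_of_continuousOn
    (hf.mono (prod_mono (subset_refl (Icc 0 T)) (subset_univ (closedBall u₀ 1))))
  refine ⟨|M|, abs_nonneg M, fun k hk hkT => ?_⟩
  let c : ℝ → ℝ := fun s => max 0 (min 1 s)
  -- `c` clamps time to the unit interval and `q` is the radial retraction onto the unit ball; both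
  -- fix the points where `g` must agree with the original map.
  let q : E → E := fun w => (max 1 ‖w‖)⁻¹ • w
  have hpos : ∀ w : E, 0 < max 1 ‖w‖ := fun w => lt_max_of_lt_left one_pos
  have hc : Continuous c := by fun_prop
  have hq : Continuous q :=
    ((continuous_const.max continuous_norm).inv₀ fun w => (hpos w).ne').smul continuous_id
  have hc0 : ∀ s, 0 ≤ c s := fun s => le_max_left _ _
  have hc1 : ∀ s, c s ≤ 1 := fun s => max_le zero_le_one (min_le_left _ _)
  have hmem : ∀ s, a + k * c s ∈ Icc 0 T := fun s =>
    ⟨add_nonneg ha (mul_nonneg hk (hc0 s)),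
      by linarith [mul_le_of_le_one_right hk (hc1 s)]⟩
  have hq1 : ∀ w, ‖q w‖ ≤ 1 := fun w => by
    rw [norm_smul, norm_inv, Real.norm_eq_abs, abs_of_pos (hpos w), inv_mul_le_iff₀ (hpos w),
      mul_one]
    exact le_max_right _ _
  refine ⟨fun p => k • f (a + k * c p.1) (u₀ + q p.2), ?_, ?_, ?_⟩
  · refine Continuous.const_smul ?_ k
    exact hf.comp_continuous (f := fun p : ℝ × E => (a + k * c p.1, u₀ + q p.2)) (by fun_prop)
      fun p => ⟨hmem p.1, mem_univ _⟩
  · intro p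
    rw [norm_smul, Real.norm_eq_abs, abs_of_nonneg hk]
    refine mul_le_mul_of_nonneg_left (le_trans ?_ (le_abs_self M)) hk
    exact hM (a + k * c p.1, u₀ + q p.2) ⟨hmem p.1, by simpa [mem_closedBall] using hq1 p.2⟩
  · intro s hs w hw
    have h1 : c s = s := by simp only [c]; rw [min_eq_right hs.2, max_eq_right hs.1]
    have h2 : q w = w := by simp only [q]; rw [max_eq_left hw, inv_one, one_smul]
    simp only [h1, h2]

theorem setIntegral_Ioo_eq_unitInterval {a k : ℝ} (hk : 0 < k) (φ : ℝ → ℝ) :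
    ∫ t in Ioo a (a + k), φ t = ∫ s in (0 : ℝ)..1, k * φ (a + k * s) := by
  rw [← integral_Ioc_eq_integral_Ioo, ← intervalIntegral.integral_of_le (by linarith),
    intervalIntegral.integral_const_mul, intervalIntegral.mul_integral_comp_add_mul]
  simp

variable {H : Type*} [NormedAddCommGroup H] [InnerProductSpace ℝ H]

theorem IsPoly.coe_mem_polySpace {Hm : Submodule ℝ H} {r : ℕ} {f : ℝ → Hm} (hf : IsPoly r f)
    (J : Set ℝ) : (fun t => (f t : H)) ∈ polySpace r J Hm := by
  refine ⟨(continuous_subtype_val.comp hf.continuous).continuousOn, ?_⟩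
  obtain ⟨x, rfl⟩ := hf
  exact ⟨x, fun t _ => by simp [polyFun_apply]⟩

theorem exists_isPoly_of_mem_polySpace {Hm : Submodule ℝ H} {r : ℕ} {a k : ℝ} (hk : 0 < k)
    {V : ℝ → H} (hV : V ∈ polySpace r (Ioo a (a + k)) Hm) :
    ∃ v : ℝ → Hm, IsPoly r v ∧ (∀ s ∈ Icc (0 : ℝ) 1, V (a + k * s) = v s) ∧
      Function.rightLim V a = v 0 := by
  obtain ⟨hVc, x, hx⟩ := hV
  rw [closure_Ioo (by linarith)] at hVc hx
  have heq : ∀ s ∈ Icc (0 : ℝ) 1, V (a + k * s) = polyFun r x (a + k * s) := by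
    intro s hs
    rw [hx _ ⟨by nlinarith [hs.1], by nlinarith [hs.2]⟩]
    simp [polyFun_apply]
  refine ⟨fun s => polyFun r x (a + k * s), (isPoly_polyFun x).comp_affine a k, heq, ?_⟩
  have h0 := heq 0 ⟨le_rfl, zero_le_one⟩
  simp only [mul_zero, add_zero] at h0 ⊢
  rw [← h0]
  exact ((hVc a ⟨le_rfl, by linarith⟩).mono_of_mem_nhdsWithin
    (Icc_mem_nhdsGE (by linarith : a < a + k))).rightLim_eq

variable {T a : ℝ} {F : ℝ → H → H} {Hm : Submodule ℝ H}

/-- The reference solution transported to `(a, a + k)`. -/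
noncomputable def transport (a k : ℝ) (u₀ : Hm) (W : ℝ → Hm) (t : ℝ) : H :=
  ((u₀ + W (-(k⁻¹ * a) + k⁻¹ * t) : Hm) : H)

theorem transport_apply {k : ℝ} (hk : 0 < k) (u₀ : Hm) (W : ℝ → Hm) (s : ℝ) :
    transport a k u₀ W (a + k * s) = ((u₀ + W s : Hm) : H) := by
  have : -(k⁻¹ * a) + k⁻¹ * (a + k * s) = s := by field_simp; ring
  rw [transport, this]

theorem transport_mem_polySpace {r : ℕ} (k : ℝ) (u₀ : Hm) {W : ℝ → Hm} (hW : IsPoly r W)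
    (J : Set ℝ) : transport a k u₀ W ∈ polySpace r J Hm :=
  ((isPoly_const r u₀).add (hW.comp_affine _ _)).coe_mem_polySpace J

theorem hasDerivAt_transport {k : ℝ} (hk : 0 < k) (u₀ : Hm) {W Z : ℝ → Hm}
    (hW : ∀ s, HasDerivAt W (Z s) s) (s : ℝ) :
    HasDerivAt (transport a k u₀ W) (k⁻¹ • (Z s : H)) (a + k * s) := by
  have hs : -(k⁻¹ * a) + k⁻¹ * (a + k * s) = s := by field_simp; ring
  have h1 : HasDerivAt (fun t => -(k⁻¹ * a) + k⁻¹ * t) k⁻¹ (a + k * s) := by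
    simpa using ((hasDerivAt_id (a + k * s)).const_mul k⁻¹).const_add (-(k⁻¹ * a))
  have h2 := HasDerivAt.scomp (a + k * s) (hs.symm ▸ hW s) h1
  refine (Hm.subtypeL.hasFDerivAt.comp_hasDerivAt _ (h2.const_add u₀)).congr_deriv ?_
  rw [hs]
  rfl

/-- The factor `k⁻¹` from the chain rule cancels the Jacobian `k`; on the right-hand side the
Jacobian is instead absorbed into `g`. -/
theorem integral_inner_deriv_transport {k : ℝ} (hk : 0 < k) (u₀ : Hm) {W Z v : ℝ → Hm}
    (hW : ∀ s, HasDerivAt W (Z s) s) {V : ℝ → H}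
    (hV : ∀ s ∈ Icc (0 : ℝ) 1, V (a + k * s) = v s) :
    ∫ t in Ioo a (a + k), inner ℝ (deriv (transport a k u₀ W) t) (V t)
      = ∫ s in (0 : ℝ)..1, inner ℝ (Z s) (v s) := by
  rw [setIntegral_Ioo_eq_unitInterval hk]
  refine intervalIntegral.integral_congr fun s hs => ?_
  rw [uIcc_of_le zero_le_one] at hs
  rw [(hasDerivAt_transport hk u₀ hW s).deriv, hV s hs, real_inner_smul_left, ← mul_assoc,
    mul_inv_cancel₀ hk.ne', one_mul, Submodule.coe_inner]

variable [FiniteDimensional ℝ Hm]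

theorem integral_inner_rhs_transport {k : ℝ} (hk : 0 < k) (u₀ : Hm) {W v : ℝ → Hm}
    {g : ℝ × Hm → Hm} (hg : ∀ s ∈ Icc (0 : ℝ) 1, ∀ w : Hm, ‖w‖ ≤ 1 →
      g (s, w) = k • Hm.orthogonalProjectionOnto (F (a + k * s) ((u₀ + w : Hm) : H)))
    (hW : ∀ s ∈ Icc (0 : ℝ) 1, ‖W s‖ ≤ 1) {V : ℝ → H}
    (hV : ∀ s ∈ Icc (0 : ℝ) 1, V (a + k * s) = v s) :
    ∫ t in Ioo a (a + k), inner ℝ (F t (transport a k u₀ W t)) (V t)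
      = ∫ s in (0 : ℝ)..1, inner ℝ (g (s, W s)) (v s) := by
  rw [setIntegral_Ioo_eq_unitInterval hk]
  refine intervalIntegral.integral_congr fun s hs => ?_
  rw [uIcc_of_le zero_le_one] at hs
  rw [hg s hs _ (hW s hs), transport_apply hk, hV s hs, real_inner_smul_left,
    Submodule.inner_orthogonalProjectionOnto_eq_of_mem_right]

theorem exists_projected_truncation (ha : 0 ≤ a)
    (hF : ContinuousOn (Function.uncurry F) (Icc 0 T ×ˢ univ)) (u₀ : Hm) :
    ∃ kmax : ℝ, 0 < kmax ∧ ∀ k, 0 < k → k ≤ kmax → a + k ≤ T →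
      ∃ (g : ℝ × Hm → Hm) (m : ℝ), Continuous g ∧ (∀ p, ‖g p‖ ≤ m) ∧ 4 * m ≤ 1 ∧
      ∀ s ∈ Icc (0 : ℝ) 1, ∀ w : Hm, ‖w‖ ≤ 1 →
        g (s, w) = k • Hm.orthogonalProjectionOnto (F (a + k * s) ((u₀ + w : Hm) : H)) := by
  have hf : ContinuousOn
      (Function.uncurry fun t (u : Hm) => Hm.orthogonalProjectionOnto (F t (u : H)))
      (Icc 0 T ×ˢ univ) :=
    Hm.orthogonalProjectionOnto.continuous.comp_continuousOn
      (hF.comp (f := fun p : ℝ × Hm => (p.1, (p.2 : H))) (by fun_prop)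
        fun p hp => ⟨hp.1, mem_univ _⟩)
  obtain ⟨M, hM0, hM⟩ := exists_truncation ha hf u₀
  -- Chosen so that the dG bound `4 k M` is at most the truncation radius `1`; the added `1` keeps
  -- the denominator positive when `M = 0`. No degree enters.
  refine ⟨1 / (4 * (M + 1)), by positivity, fun k hk hkmax hkT => ?_⟩
  obtain ⟨g, hg, hgM, hgeq⟩ := hM k hk.le hkT
  refine ⟨g, k * M, hg, hgM, ?_, hgeq⟩
  rw [le_div_iff₀ (by positivity)] at hkmax
  nlinarith

theorem exists_isCGSolution (ha : 0 ≤ a)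
    (hF : ContinuousOn (Function.uncurry F) (Icc 0 T ×ˢ univ)) (Uprev : H) :
    ∃ kmax : ℝ, 0 < kmax ∧ ∀ k, 0 < k → k ≤ kmax → a + k ≤ T → ∀ r : ℕ,
      ∃ U : ℝ → H, IsCGSolution F Hm a k r Uprev U := by
  let u₀ := Hm.orthogonalProjectionOnto Uprev
  obtain ⟨kmax, hkmax, h⟩ := exists_projected_truncation ha hF u₀
  refine ⟨kmax, hkmax, fun k hk hkk hkT r => ?_⟩
  obtain ⟨g, m, hg, hgm, hm, hgeq⟩ := h k hk hkk hkT
  have hm0 : 0 ≤ m := (norm_nonneg _).trans (hgm 0)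
  obtain ⟨W, Z, hWp, -, hWZ, hW0, hWm, hweak⟩ := exists_cg_reference r hg hgm
  refine ⟨transport a k u₀ W, transport_mem_polySpace k u₀ hWp _, ?_, fun V hV => ?_⟩
  · have h0 := transport_apply (a := a) hk u₀ W 0
    rw [mul_zero, add_zero, hW0, add_zero] at h0
    exact h0
  · obtain ⟨v, hv, hVv, -⟩ := exists_isPoly_of_mem_polySpace hk hV
    rw [integral_inner_deriv_transport hk u₀ hWZ hVv,
      integral_inner_rhs_transport hk u₀ hgeq (fun s hs => (hWm s hs).trans (by linarith)) hVv]
    exact hweak v hv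

theorem exists_isDGSolution (ha : 0 ≤ a)
    (hF : ContinuousOn (Function.uncurry F) (Icc 0 T ×ˢ univ)) (Uprev : H) :
    ∃ kmax : ℝ, 0 < kmax ∧ ∀ k, 0 < k → k ≤ kmax → a + k ≤ T → ∀ r : ℕ,
      ∃ U : ℝ → H, IsDGSolution F Hm a k r Uprev U := by
  let u₀ := Hm.orthogonalProjectionOnto Uprev
  obtain ⟨kmax, hkmax, h⟩ := exists_projected_truncation ha hF u₀
  refine ⟨kmax, hkmax, fun k hk hkk hkT r => ?_⟩
  obtain ⟨g, m, hg, hgm, hm, hgeq⟩ := h k hk hkk hkT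
  obtain ⟨W, Z, hWp, hWZ, hWm, hweak⟩ := exists_dg_reference r hg hgm
  have hmem := transport_mem_polySpace (a := a) k u₀ hWp (Ioo a (a + k))
  refine ⟨transport a k u₀ W, hmem, fun V hV => ?_⟩
  obtain ⟨v, hv, hVv, hV0⟩ := exists_isPoly_of_mem_polySpace hk hV
  have hU0 : Function.rightLim (transport a k u₀ W) a = ((u₀ + W 0 : Hm) : H) := by
    obtain ⟨u, -, huU, hu0⟩ := exists_isPoly_of_mem_polySpace hk hmem
    rw [hu0, ← huU 0 ⟨le_rfl, zero_le_one⟩, transport_apply hk]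
  -- `Uprev` and its projection `u₀` have the same inner product with elements of `Hm`, so only `W
  -- 0` remains of the jump.
  have hjump : inner ℝ (((u₀ + W 0 : Hm) : H) - Uprev) (v 0 : H) = inner ℝ (W 0) (v 0) := by
    have h1 : inner ℝ (u₀ : H) (v 0 : H) = inner ℝ Uprev (v 0 : H) := by
      rw [← Submodule.coe_inner, Submodule.inner_orthogonalProjectionOnto_eq_of_mem_right]
    rw [inner_sub_left, Submodule.coe_add, inner_add_left, h1, Submodule.coe_inner]
    ring
  rw [integral_inner_deriv_transport hk u₀ hWZ hVv,
    integral_inner_rhs_transport hk u₀ hgeq (fun s hs => (hWm s hs).trans hm) hVv, hU0, hV0, hjump]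
  exact hweak v hv

end Assembly

end GalerkinTimeStepping

theorem theorem3p1 {H : Type*} [NormedAddCommGroup H] [InnerProductSpace ℝ H] [CompleteSpace H]
    (T : ℝ) (F : ℝ → H → H)
    (hF : ContinuousOn (Function.uncurry F) (Set.Icc 0 T ×ˢ Set.univ))
    (Hm : Submodule ℝ H) [FiniteDimensional ℝ Hm]
    (a : ℝ) (ha : 0 ≤ a) (haT : a < T) (UprevCG UprevDG : H) :
    ∃ kmax : ℝ, 0 < kmax ∧ ∀ k : ℝ, 0 < k → k ≤ kmax → a + k ≤ T → ∀ r : ℕ,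
      (∃ U : ℝ → H, GalerkinTimeStepping.IsCGSolution F Hm a k r UprevCG U) ∧
      (∃ U : ℝ → H, GalerkinTimeStepping.IsDGSolution F Hm a k r UprevDG U) := by
  obtain ⟨k₁, hk₁, h₁⟩ := GalerkinTimeStepping.exists_isCGSolution (Hm := Hm) ha hF UprevCG
  obtain ⟨k₂, hk₂, h₂⟩ := GalerkinTimeStepping.exists_isDGSolution (Hm := Hm) ha hF UprevDG
  exact ⟨min k₁ k₂, lt_min hk₁ hk₂, fun k hk hkk hkT r =>
    ⟨h₁ k hk (hkk.trans (min_le_left _ _)) hkT r, h₂ k hk (hkk.trans (min_le_right _ _)) hkT r⟩⟩
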